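/- Let $n\ge 1$ be an integer, let $k>0$ and $\phi,\theta$ be real numbers, and let $N\ge 0$ be an integer. Write $(x)_j=x(x+1)\cdots(x+j-1)$ for the Pochhammer symbol, $b^{\theta,n}_s=\cos(\theta+2\pi s/n)$ for $s=1,\dots,n$, and $$C_j^{(k)}(x)=\sum_{0\le l\le j/2}(-1)^l\frac{(k)_{j-l}}{l!\,(j-2l)!}(2x)^{j-2l}$$ for the Gegenbauer polynomials. Put $$S_N(n,k,\phi,\theta)=\sum_{\substack{j,m\ge 0\\ 2m+nj=N}}\frac{n(j+k)}{m!\,\Gamma(n(j+k)+m+1)}\,\frac{C_j^{(k)}(\cos n\phi)\,C_j^{(k)}(\cos n\theta)}{C_j^{(k)}(1)}.$$ Then $$S_N(n,k,\phi,\theta)=\frac{2^N}{\Gamma(nk+N)}\sum_{\substack{m_1,\dots,m_n\ge 0\\ m_1+\dots+m_n=N}}\ \sum_{j=0}^{\min(m_1,\dots,m_n)}\frac{(k)_j(k)_j}{(2k)_j\,j!}\bigl(-2^{2-n}\sin(n\theta)\sin(n\phi)\bigr)^j\prod_{s=1}^n\frac{(k+j)_{m_s-j}}{(m_s-j)!}\bigl(b^{\theta-\phi,n}_s\bigr)^{m_s-j}.$$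 In particular, for $\phi=0$, $$S_N(n,k,0,\theta)=\frac{2^N}{\Gamma(nk+N)}\sum_{\substack{m_1,\dots,m_n\ge 0\\ m_1+\dots+m_n=N}}\ \prod_{s=1}^n(k)_{m_s}\frac{\bigl(b^{\theta,n}_s\bigr)^{m_s}}{m_s!}.$$ -/

import Mathlib

noncomputable section

namespace DihedralGegenbauer

/-- The Pochhammer symbol `(x)_j = x (x + 1) ⋯ (x + j - 1)`. -/
def poch (x : ℝ) (j : ℕ) : ℝ := (ascPochhammer ℝ j).eval x

/-- The (non-normalized) Gegenbauer polynomial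
`C_j^{(k)}(X) = ∑_{0 ≤ 2l ≤ j} (-1)^l (k)_{j-l} / (l! (j-2l)!) (2X)^{j-2l}`. -/
def gegenbauer (k : ℝ) (j : ℕ) : Polynomial ℝ :=
  ∑ l ∈ Finset.range (j / 2 + 1),
    Polynomial.C ((-1) ^ l * poch k (j - l) / ((l.factorial : ℝ) * ((j - 2 * l).factorial : ℝ))) *
      (2 * Polynomial.X) ^ (j - 2 * l)

/-- The pairs `(j, m)` of natural numbers with `2 m + n j = N`; for `n ≥ 1` every such pair has
`j, m ≤ N`, so nothing is lost by the bounds. -/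
def indexPairs (N n : ℕ) : Finset (ℕ × ℕ) :=
  (Finset.range (N + 1) ×ˢ Finset.range (N + 1)).filter fun p => 2 * p.2 + n * p.1 = N

/-- The finite sum `S_N(n, k, φ, θ)`. -/
def S (N n : ℕ) (k φ θ : ℝ) : ℝ :=
  ∑ p ∈ indexPairs N n,
    (n : ℝ) * ((p.1 : ℝ) + k) /
        ((p.2.factorial : ℝ) * Real.Gamma ((n : ℝ) * ((p.1 : ℝ) + k) + (p.2 : ℝ) + 1)) *
      ((gegenbauer k p.1).eval (Real.cos (n * φ)) * (gegenbauer k p.1).eval (Real.cos (n * θ)) /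
        (gegenbauer k p.1).eval 1)

/-- `b_s^{θ,n} = cos (θ + 2 π s / n)`. -/
def b (θ : ℝ) (n s : ℕ) : ℝ := Real.cos (θ + 2 * Real.pi * (s : ℝ) / (n : ℝ))

end DihedralGegenbauer

end

/-! Two ingredients give the result. First, `gegenbauer_mul_gegenbauer` rewrites a normalized
product of Gegenbauer polynomials at `cos A` and `cos B` as a combination of `C_{j-i}^{(k+i)}(cos (A
- B))`. As functions of `A` both sides solve the same singular second-order ODE and agree at `A =
0`, and an energy estimate gives uniqueness. Second, `sum_piAntidiag_eq_sum_indexPairs` handles sums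
with a single Gegenbauer factor. Let `c = 1 + X² c²` be the Catalan series in `X²` and `z = X c`;
then `c (1 - 2 b X) = 1 - 2 b z + z²`. The product of these over `b = b_s` is `1 - 2 cos(nα) zⁿ +
z²ⁿ`, so `∏ (1 - 2 b_s X)^(-κ)` equals `∑ C_l^{(κ)}(cos nα) X^(nl) c^(n(l+κ))`. The coefficients of
powers of `c` are exactly the Gamma quotients in `S`, up to a factor depending only on `nk + N`.
Inserting the first expansion into `S` and applying the second with `κ = k + j` and `N - nj` in
place of `N` gives the formula. -/

noncomputable section

namespace DihedralGegenbauer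

/-! ### Gegenbauer polynomials: derivatives, differential equation, positivity at 1. -/

section GegenbauerPolynomials

open Polynomial Finset

@[simp]
lemma poch_zero (x : ℝ) : poch x 0 = 1 := by simp [poch]

lemma poch_succ (x : ℝ) (j : ℕ) : poch x (j + 1) = poch x j * (x + j) :=
  ascPochhammer_succ_eval j x

lemma poch_succ_left (x : ℝ) (j : ℕ) : poch x (j + 1) = x * poch (x + 1) j := by
  simp [poch, ascPochhammer_succ_left]

lemma poch_pos {x : ℝ} (hx : 0 < x) (j : ℕ) : 0 < poch x j := ascPochhammer_pos j x hx

lemma poch_mul_Gamma {x : ℝ} (hx : 0 < x) (j : ℕ) :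
    poch x j * Real.Gamma x = Real.Gamma (x + j) := by
  induction j with
  | zero => simp
  | succ j ih =>
    rw [poch_succ, mul_right_comm, ih, Nat.cast_succ, ← add_assoc,
      Real.Gamma_add_one (by positivity), mul_comm]

/-- The coefficient of `(2X)^(j-2l)` in the Gegenbauer polynomial `C_j^{(k)}`. -/
def gegenbauerCoeff (k : ℝ) (j l : ℕ) : ℝ :=
  (-1) ^ l * poch k (j - l) / ((l.factorial : ℝ) * ((j - 2 * l).factorial : ℝ))

lemma gegenbauer_eq_sum (k : ℝ) (j : ℕ) :
    gegenbauer k j = ∑ l ∈ range (j / 2 + 1), C (gegenbauerCoeff k j l) * (2 * X) ^ (j - 2 * l) :=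
  rfl

lemma gegenbauerCoeff_two_mul_add (k : ℝ) (r l : ℕ) :
    gegenbauerCoeff k (2 * l + r) l =
      (-1) ^ l * poch k (l + r) / ((l.factorial : ℝ) * (r.factorial : ℝ)) := by
  rw [gegenbauerCoeff, Nat.add_sub_cancel_left, show 2 * l + r - l = l + r by omega]

lemma derivative_two_mul_X_pow (r : ℕ) :
    derivative ((2 * X : ℝ[X]) ^ r) = C (2 * r : ℝ) * (2 * X) ^ (r - 1) := by
  rw [derivative_pow, show (2 * X : ℝ[X]) = C 2 * X from rfl, derivative_C_mul_X]
  simp only [map_mul, map_natCast]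
  ring

@[simp]
lemma gegenbauer_zero (k : ℝ) : gegenbauer k 0 = 1 := by
  simp [gegenbauer_eq_sum, gegenbauerCoeff]

lemma derivative_gegenbauer_succ (k : ℝ) (j : ℕ) :
    derivative (gegenbauer k (j + 1)) = C (2 * k) * gegenbauer (k + 1) j := by
  have key : ∀ l, 2 * l ≤ j →
      derivative (C (gegenbauerCoeff k (j + 1) l) * (2 * X) ^ (j + 1 - 2 * l)) =
        C (2 * k) * (C (gegenbauerCoeff (k + 1) j l) * (2 * X) ^ (j - 2 * l)) := by
    intro l hl
    obtain ⟨r, rfl⟩ := Nat.exists_eq_add_of_le hl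
    rw [derivative_C_mul, derivative_two_mul_X_pow, add_assoc, gegenbauerCoeff_two_mul_add,
      gegenbauerCoeff_two_mul_add, Nat.add_sub_cancel_left, Nat.add_sub_cancel_left,
      Nat.add_sub_cancel, ← mul_assoc, ← mul_assoc, ← C_mul, ← C_mul]
    congr 2
    rw [← add_assoc, poch_succ_left, Nat.factorial_succ]
    push_cast
    field_simp
  rw [gegenbauer_eq_sum, gegenbauer_eq_sum, derivative_sum, mul_sum]
  rcases Nat.even_or_odd' j with ⟨M, rfl | rfl⟩
  · rw [show (2 * M + 1) / 2 = M by omega, show 2 * M / 2 = M by omega]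
    exact sum_congr rfl fun l hl => key l (by rw [mem_range] at hl; omega)
  · rw [show (2 * M + 1 + 1) / 2 = M + 1 by omega, show (2 * M + 1) / 2 = M by omega,
      sum_range_succ, show 2 * M + 1 + 1 - 2 * (M + 1) = 0 by omega]
    simp only [pow_zero, mul_one, derivative_C, add_zero]
    exact sum_congr rfl fun l hl => key l (by rw [mem_range] at hl; omega)

lemma iterate_derivative_gegenbauer (k : ℝ) (i j : ℕ) :
    derivative^[i] (gegenbauer k (i + j)) = C (2 ^ i * poch k i) * gegenbauer (k + i) j := by
  induction i generalizing k with
  | zero => simp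
  | succ i ih =>
    rw [Function.iterate_succ_apply, show i + 1 + j = i + j + 1 by ring,
      derivative_gegenbauer_succ, iterate_derivative_C_mul, ih, ← mul_assoc, ← C_mul,
      poch_succ_left]
    push_cast
    rw [show k + 1 + (i : ℝ) = k + (i + 1) by ring]
    congr 2
    ring

lemma iterate_derivative_gegenbauer_eq_zero (k : ℝ) {i j : ℕ} (h : j < i) :
    derivative^[i] (gegenbauer k j) = 0 := by
  obtain ⟨d, rfl⟩ := Nat.exists_eq_add_of_lt h
  have := iterate_derivative_gegenbauer k j 0
  rw [add_zero] at this
  rw [show j + d + 1 = (d + 1) + j by ring, Function.iterate_add_apply, this, gegenbauer_zero,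
    mul_one, iterate_derivative_C (Nat.succ_pos d)]

/-- `P` solves the Gegenbauer differential equation with parameter `k` and eigenvalue `μ`. -/
def IsGegenbauerSol (k μ : ℝ) (P : ℝ[X]) : Prop :=
  (1 - X ^ 2) * derivative (derivative P) - C (2 * k + 1) * X * derivative P + C μ * P = 0

lemma isGegenbauerSol_gegenbauer (k : ℝ) (j : ℕ) :
    IsGegenbauerSol k (j * (j + 2 * k)) (gegenbauer k j) := by
  have hX : ∀ r : ℕ, X * derivative ((2 * X : ℝ[X]) ^ r) = C (r : ℝ) * (2 * X) ^ r := by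
    intro r
    rw [derivative_two_mul_X_pow]
    rcases r with _ | r
    · simp
    · simp only [Nat.add_sub_cancel, map_mul, pow_succ]
      simp only [show (C 2 : ℝ[X]) = 2 from rfl]
      ring
  have hDD : ∀ r : ℕ, derivative (derivative ((2 * X : ℝ[X]) ^ r)) =
      C (4 * (r * (r - 1)) : ℝ) * (2 * X) ^ (r - 2) := by
    intro r
    rw [derivative_two_mul_X_pow, derivative_C_mul, derivative_two_mul_X_pow, ← mul_assoc,
      ← C_mul, Nat.sub_sub]
    congr 2
    rcases r with _ | r
    · simp
    · push_cast
      ring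
  have hXX : ∀ r : ℕ, X ^ 2 * derivative (derivative ((2 * X : ℝ[X]) ^ r)) =
      C (r * (r - 1) : ℝ) * (2 * X) ^ r := by
    intro r
    rw [hDD]
    rcases r with _ | _ | r
    · simp
    · simp
    · rw [show r + 1 + 1 - 2 = r by omega, pow_add, pow_add, C_mul]
      simp only [show (C 4 : ℝ[X]) = 4 from rfl]
      ring
  set u : ℕ → ℝ[X] := fun l => C (gegenbauerCoeff k j l) *
    derivative (derivative ((2 * X) ^ (j - 2 * l))) with hu
  set v : ℕ → ℝ[X] := fun l => C (gegenbauerCoeff k j l * (j * (j + 2 * k) -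
      (j - 2 * l : ℕ) * ((j - 2 * l : ℕ) - 1) - (2 * k + 1) * (j - 2 * l : ℕ))) *
    (2 * X) ^ (j - 2 * l) with hv
  have hsplit : (1 - X ^ 2) * derivative (derivative (gegenbauer k j)) -
      C (2 * k + 1) * X * derivative (gegenbauer k j) + C ((j : ℝ) * (j + 2 * k)) * gegenbauer k j =
      ∑ l ∈ range (j / 2 + 1), u l + ∑ l ∈ range (j / 2 + 1), v l := by
    rw [gegenbauer_eq_sum, derivative_sum, derivative_sum, mul_sum, mul_sum, mul_sum,
      ← sum_sub_distrib, ← sum_add_distrib, ← sum_add_distrib]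
    refine sum_congr rfl fun l _ => ?_
    simp only [derivative_C_mul, hu, hv]
    have h1 := hX (j - 2 * l)
    have h2 := hXX (j - 2 * l)
    simp only [C_mul, C_sub, C_add] at h1 h2 ⊢
    linear_combination (-C (gegenbauerCoeff k j l)) * h2 -
      (C 2 * C k + C 1) * C (gegenbauerCoeff k j l) * h1
  rw [IsGegenbauerSol, hsplit, sum_range_succ, sum_range_succ' v]
  have hutop : u (j / 2) = 0 := by
    simp only [hu, hDD]
    obtain h | h : j - 2 * (j / 2) = 0 ∨ j - 2 * (j / 2) = 1 := by omega
    all_goals simp [h]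
  have hv0 : v 0 = 0 := by
    simp only [hv]
    convert zero_mul _
    rw [← C_0]
    congr 1
    simp
    right
    ring
  -- Only the bare second derivative lowers the degree, by two; the other terms act diagonally on
  -- powers of `2X`. Hence `u l` cancels the next diagonal term, and the eigenvalue kills the
  -- leading one `v 0`.
  have hstep : ∀ l ∈ range (j / 2), u l = - v (l + 1) := by
    intro l hl
    rw [mem_range] at hl
    obtain ⟨r, rfl⟩ := Nat.exists_eq_add_of_le (show 2 * (l + 1) ≤ j by omega)
    simp only [hu, hv, hDD]
    rw [Nat.add_sub_cancel_left, show 2 * (l + 1) + r - 2 * l = r + 2 by omega,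
      gegenbauerCoeff_two_mul_add, show 2 * (l + 1) + r = 2 * l + (r + 2) by ring,
      gegenbauerCoeff_two_mul_add, ← mul_assoc, ← C_mul, ← neg_mul, ← C_neg, Nat.add_sub_cancel]
    congr 2
    rw [show l + (r + 2) = l + 1 + r + 1 by ring, poch_succ, Nat.factorial_succ, Nat.factorial_succ,
      Nat.factorial_succ]
    push_cast
    field_simp
    ring
  rw [hutop, hv0, sum_congr rfl hstep, sum_neg_distrib]
  ring

lemma IsGegenbauerSol.iterate {k μ : ℝ} {P : ℝ[X]} (h : IsGegenbauerSol k μ P) (i : ℕ) :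
    IsGegenbauerSol (k + i) (μ - i * (2 * k + i)) (derivative^[i] P) := by
  induction i with
  | zero => simpa using h
  | succ i ih =>
    have := congrArg derivative ih
    rw [IsGegenbauerSol]
    rw [Function.iterate_succ_apply']
    simp only [derivative_add, derivative_sub, derivative_mul, derivative_C, derivative_X,
      derivative_X_pow, derivative_one, derivative_zero] at this
    simp only [Nat.cast_add, Nat.cast_one, C_add, C_mul, C_sub, C_1] at this ⊢
    simp only [Nat.cast_ofNat, show (C 2 : ℝ[X]) = 2 from rfl] at this ⊢
    linear_combination this

/-- At `X = 1` the ODE loses its second-order term and expresses the value as a positive multiple of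
the derivative, which has lower degree and parameter `k + 1`. -/
lemma gegenbauer_eval_one_pos {k : ℝ} (hk : 0 < k) (j : ℕ) : 0 < (gegenbauer k j).eval 1 := by
  induction j generalizing k with
  | zero => simp
  | succ j ih =>
    have h := congrArg (eval 1) (isGegenbauerSol_gegenbauer k (j + 1))
    have hpos := ih (k := k + 1) (by linarith)
    simp [derivative_gegenbauer_succ] at h
    have h2 : ((j : ℝ) + 1) * (j + 1 + 2 * k) * (gegenbauer k (j + 1)).eval 1 =
        (2 * k + 1) * (2 * k * (gegenbauer (k + 1) j).eval 1) := by linarith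
    have h3 : 0 < (2 * k + 1) * (2 * k * (gegenbauer (k + 1) j).eval 1) := by positivity
    rw [← h2] at h3
    exact pos_of_mul_pos_right h3 (by positivity)

end GegenbauerPolynomials

/-! ### The product formula, by uniqueness for a singular ODE. -/

section ProductFormula

open Polynomial Finset

/-- The trigonometric form of the Gegenbauer differential equation. -/
def IsTrigSol (k μ : ℝ) (f : ℝ → ℝ) : Prop :=
  ∃ f' f'' : ℝ → ℝ, (∀ A, HasDerivAt f (f' A) A) ∧ (∀ A, HasDerivAt f' (f'' A) A) ∧
    ∀ A, Real.sin A * f'' A + 2 * k * Real.cos A * f' A + μ * Real.sin A * f A = 0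

lemma IsTrigSol.const_mul {k μ : ℝ} {f : ℝ → ℝ} (hf : IsTrigSol k μ f) (c : ℝ) :
    IsTrigSol k μ (fun A => c * f A) := by
  obtain ⟨f', f'', h1, h2, h3⟩ := hf
  exact ⟨fun A => c * f' A, fun A => c * f'' A, fun A => (h1 A).const_mul c,
    fun A => (h2 A).const_mul c, fun A => by linear_combination c * h3 A⟩

lemma IsTrigSol.sub {k μ : ℝ} {f g : ℝ → ℝ} (hf : IsTrigSol k μ f) (hg : IsTrigSol k μ g) :
    IsTrigSol k μ (fun A => f A - g A) := by
  obtain ⟨f', f'', h1, h2, h3⟩ := hf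
  obtain ⟨g', g'', k1, k2, k3⟩ := hg
  exact ⟨fun A => f' A - g' A, fun A => f'' A - g'' A, fun A => (h1 A).sub (k1 A),
    fun A => (h2 A).sub (k2 A), fun A => by linear_combination h3 A - k3 A⟩

/-- A solution vanishing at the singular point `0` vanishes on `[0, π/2]`: the sum of
the square of its derivative and `μ` times its own square is nonincreasing there. -/
lemma IsTrigSol.eq_zero_of_mem_Icc {k μ : ℝ} (hk : 0 < k) (hμ : 0 < μ) {f : ℝ → ℝ}
    (hf : IsTrigSol k μ f) (h0 : f 0 = 0) {A : ℝ} (hA : A ∈ Set.Icc 0 (Real.pi / 2)) :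
    f A = 0 := by
  obtain ⟨f', f'', h1, h2, h3⟩ := hf
  -- At the singular point the equation itself forces `2k f'(0) = 0`, so one initial condition
  -- suffices.
  have hf'0 : f' 0 = 0 := by
    have := h3 0
    simp only [Real.sin_zero, Real.cos_zero] at this
    have h : k * f' 0 = 0 := by linarith
    exact (mul_eq_zero.1 h).resolve_left hk.ne'
  have hE : ∀ A, HasDerivAt (fun A => f' A ^ 2 + μ * f A ^ 2)
      (2 * f' A * f'' A + μ * (2 * f A * f' A)) A := by
    intro A
    have := ((h2 A).pow 2).add (((h1 A).pow 2).const_mul μ)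
    refine this.congr_deriv ?_
    push_cast
    ring
  have hanti : AntitoneOn (fun A => f' A ^ 2 + μ * f A ^ 2) (Set.Icc 0 (Real.pi / 2)) := by
    refine antitoneOn_of_deriv_nonpos (convex_Icc _ _)
      (fun A _ => (hE A).continuousAt.continuousWithinAt)
      (fun A _ => (hE A).differentiableAt.differentiableWithinAt) fun A hA => ?_
    rw [interior_Icc] at hA
    rw [(hE A).deriv]
    have hs : 0 < Real.sin A :=
      Real.sin_pos_of_pos_of_lt_pi hA.1 (by linarith [hA.2, Real.pi_pos])
    have hc : 0 < Real.cos A := Real.cos_pos_of_mem_Ioo ⟨by linarith [hA.1, Real.pi_pos], hA.2⟩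
    have h : Real.sin A * (2 * f' A * f'' A + μ * (2 * f A * f' A)) =
        -(4 * k * Real.cos A * f' A ^ 2) := by linear_combination 2 * f' A * h3 A
    have h' : 0 ≤ 4 * k * Real.cos A * f' A ^ 2 := by positivity
    by_contra! hlt
    have := mul_pos hs hlt
    linarith
  have hle := hanti (Set.left_mem_Icc.2 (by positivity)) hA hA.1
  simp only [h0, hf'0] at hle
  have : μ * f A ^ 2 = 0 := le_antisymm (by nlinarith [sq_nonneg (f' A)]) (by positivity)
  simpa [hμ.ne'] using this

/-- The energy argument needs `cos A ≥ 0`; analyticity carries the vanishing from `[0, π/2]` to the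
whole line. -/
lemma IsTrigSol.eq_zero {k μ : ℝ} (hk : 0 < k) (hμ : 0 < μ) {f : ℝ → ℝ}
    (hf : IsTrigSol k μ f) (ha : AnalyticOnNhd ℝ f Set.univ) (h0 : f 0 = 0) (A : ℝ) :
    f A = 0 := by
  have hpi := Real.pi_pos
  have hev : f =ᶠ[nhds (Real.pi / 4)] 0 := by
    filter_upwards [Icc_mem_nhds (show (0 : ℝ) < Real.pi / 4 by positivity)
      (show Real.pi / 4 < Real.pi / 2 by linarith)] with A hA
    exact hf.eq_zero_of_mem_Icc hk hμ h0 hA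
  exact ha.eqOn_zero_of_preconnected_of_eventuallyEq_zero isPreconnected_univ (Set.mem_univ _) hev
    (Set.mem_univ A)

lemma hasDerivAt_eval_cos_sub (P : ℝ[X]) (B A : ℝ) :
    HasDerivAt (fun A => P.eval (Real.cos (A - B)))
      (-(Real.sin (A - B) * (derivative P).eval (Real.cos (A - B)))) A := by
  have h := (P.hasDerivAt (Real.cos (A - B))).comp A
    ((Real.hasDerivAt_cos (A - B)).comp A ((hasDerivAt_id A).sub_const B))
  exact h.congr_deriv (by ring)

lemma isTrigSol_eval_cos {k μ : ℝ} {P : ℝ[X]} (hP : IsGegenbauerSol k μ P) :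
    IsTrigSol k μ (fun A => P.eval (Real.cos A)) := by
  have hd : ∀ (Q : ℝ[X]) A, HasDerivAt (fun A => Q.eval (Real.cos A))
      (-(Real.sin A * (derivative Q).eval (Real.cos A))) A := fun Q A => by
    simpa using hasDerivAt_eval_cos_sub Q 0 A
  refine ⟨_, _, hd P, fun A => ((Real.hasDerivAt_sin A).mul (hd (derivative P) A)).neg, fun A => ?_⟩
  have h := congrArg (eval (Real.cos A)) hP
  simp only [eval_add, eval_sub, eval_mul, eval_pow, eval_X, eval_C, eval_one, eval_zero] at h
  linear_combination Real.sin A * h +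
    Real.sin A * (derivative (derivative P)).eval (Real.cos A) * Real.sin_sq_add_cos_sq A

/-- The terms of the Taylor expansion that represents a product of Gegenbauer polynomials. -/
def productTerm (k : ℝ) (P : ℝ[X]) (B : ℝ) (i : ℕ) (A : ℝ) : ℝ :=
  poch k i * (-2 * Real.sin B) ^ i / (poch (2 * k) i * (i.factorial : ℝ)) *
    (Real.sin A ^ i * (derivative^[i] P).eval (Real.cos (A - B)))

/-- The differential operator sends the `i`-th term to a difference `u i - u (i + 1)`, so the sum
telescopes. The coefficients are chosen to satisfy the recursion `hrec` that makes this happen. -/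
lemma isTrigSol_sum_productTerm {k μ : ℝ} (hk : 0 < k) {P : ℝ[X]} (hP : IsGegenbauerSol k μ P)
    (B : ℝ) {J : ℕ} (hJ : derivative^[J] P = 0) :
    IsTrigSol k μ (fun A => ∑ i ∈ range J, productTerm k P B i A) := by
  set p : ℕ → ℝ → ℝ := fun i A => (derivative^[i] P).eval (Real.cos (A - B)) with hp
  have hpd : ∀ i A, HasDerivAt (p i) (-(Real.sin (A - B) * p (i + 1) A)) A := fun i A => by
    simp only [hp, Function.iterate_succ_apply']
    exact hasDerivAt_eval_cos_sub _ B A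
  set a : ℕ → ℝ := fun i =>
    poch k i * (-2 * Real.sin B) ^ i / (poch (2 * k) i * (i.factorial : ℝ)) with ha
  have hrec : ∀ i, a (i + 1) * ((i + 1) * (i + 2 * k)) = -(a i * (2 * (k + i) * Real.sin B)) := by
    intro i
    have h1 := (poch_pos (show 0 < 2 * k by positivity) i).ne'
    have h2 : (2 * k + i) ≠ 0 := by positivity
    simp only [ha, poch_succ, Nat.factorial_succ, pow_succ]
    push_cast
    field_simp
    ring
  have hs : ∀ (i : ℕ) A, (i : ℝ) * Real.sin A ^ (i - 1) * Real.sin A = i * Real.sin A ^ i := by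
    intro i A
    rcases i with _ | i
    · simp
    · rw [Nat.add_sub_cancel, pow_succ]; ring
  have hsd : ∀ (i : ℕ) A, HasDerivAt (fun A => Real.sin A ^ i)
      (i * Real.sin A ^ (i - 1) * Real.cos A) A := fun i A => (Real.hasDerivAt_sin A).pow i
  have hD1 : ∀ i A, HasDerivAt (fun A => Real.sin A ^ i * p i A)
      (i * Real.sin A ^ (i - 1) * Real.cos A * p i A +
        Real.sin A ^ i * (-(Real.sin (A - B) * p (i + 1) A))) A :=
    fun i A => (hsd i A).mul (hpd i A)
  have hsin : ∀ A, HasDerivAt (fun A => Real.sin (A - B)) (Real.cos (A - B)) A := fun A =>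
    (Real.hasDerivAt_sin (A - B)).comp_sub_const A B
  have hD2 : ∀ i A, HasDerivAt (fun A => i * Real.sin A ^ (i - 1) * Real.cos A * p i A +
        Real.sin A ^ i * (-(Real.sin (A - B) * p (i + 1) A)))
      ((i * ((i - 1 : ℕ) * Real.sin A ^ (i - 1 - 1) * Real.cos A) * Real.cos A +
          i * Real.sin A ^ (i - 1) * -Real.sin A) * p i A +
        i * Real.sin A ^ (i - 1) * Real.cos A * -(Real.sin (A - B) * p (i + 1) A) +
        (i * Real.sin A ^ (i - 1) * Real.cos A * -(Real.sin (A - B) * p (i + 1) A) +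
        Real.sin A ^ i * -(Real.cos (A - B) * p (i + 1) A +
          Real.sin (A - B) * -(Real.sin (A - B) * p (i + 2) A)))) A := fun i A =>
    ((((hsd (i - 1) A).const_mul (i : ℝ)).mul (Real.hasDerivAt_cos A)).mul
      (hpd i A)).add ((hsd i A).mul ((hsin A).mul (hpd (i + 1) A)).neg)
  refine ⟨fun A => ∑ i ∈ range J, a i * _, fun A => ∑ i ∈ range J, a i * _,
    fun A => HasDerivAt.fun_sum fun i _ => (hD1 i A).const_mul (a i),
    fun A => HasDerivAt.fun_sum fun i _ => (hD2 i A).const_mul (a i), fun A => ?_⟩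
  -- Both ends vanish: `u 0` by its factor `i`, and `u J` because the `J`-th derivative of `P` is
  -- zero.
  set u : ℕ → ℝ := fun i => a i * (i * (i - 1 + 2 * k) * Real.sin A ^ (i - 1) * p i A) with hu
  have htele : ∑ i ∈ range J, (u i - u (i + 1)) = 0 := by
    rw [sum_range_sub']
    simp [hu, hp, hJ]
  rw [← htele]
  simp only [mul_sum, productTerm]
  rw [← sum_add_distrib, ← sum_add_distrib]
  refine sum_congr rfl fun i _ => ?_
  have hode := congrArg (eval (Real.cos (A - B))) (hP.iterate i)
  simp only [eval_add, eval_sub, eval_mul, eval_pow, eval_X, eval_C, eval_one, eval_zero,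
    ← Function.iterate_succ_apply' (derivative (R := ℝ))] at hode
  change (1 - Real.cos (A - B) ^ 2) * p (i + 2) A - (2 * (k + i) + 1) * Real.cos (A - B) *
    p (i + 1) A + (μ - i * (2 * k + i)) * p i A = 0 at hode
  have hsin_add : Real.sin B =
      Real.sin A * Real.cos (A - B) - Real.cos A * Real.sin (A - B) := by
    rw [← Real.sin_sub]; congr 1; ring
  have hu1 : u (i + 1) = -(a i * (2 * (k + i) * Real.sin B)) * Real.sin A ^ i * p (i + 1) A := by
    simp only [hu, ← hrec, Nat.add_sub_cancel]
    push_cast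
    ring
  rw [hu1]
  change _ + μ * Real.sin A * (a i * (Real.sin A ^ i * p i A)) = _
  have hc := Real.sin_sq_add_cos_sq A
  have hc' := Real.sin_sq_add_cos_sq (A - B)
  simp only [hu]
  rcases i with _ | i
  · simp only [Nat.cast_zero, pow_zero, zero_add] at *
    linear_combination a 0 * Real.sin A * hode + a 0 * Real.sin A * p 2 A * hc' -
      2 * k * a 0 * p 1 A * hsin_add
  · have h' := hs i A
    simp only [Nat.add_sub_cancel, Nat.cast_add, Nat.cast_one, pow_succ _ i] at *
    linear_combination a (i + 1) * (i + 1) * Real.cos A ^ 2 * p (i + 1) A * h' +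
      a (i + 1) * Real.sin A ^ 2 * Real.sin A ^ i * hode +
      a (i + 1) * Real.sin A ^ 2 * Real.sin A ^ i * p (i + 3) A * hc' +
      a (i + 1) * (i + 1) * (i + 2 * k) * Real.sin A ^ i * p (i + 1) A * hc -
      2 * (k + i + 1) * a (i + 1) * Real.sin A ^ i * Real.sin A * p (i + 2) A * hsin_add

/-- The generalized addition formula for Gegenbauer polynomials. -/
theorem gegenbauer_mul_gegenbauer {k : ℝ} (hk : 0 < k) (j : ℕ) (A B : ℝ) :
    (gegenbauer k j).eval (Real.cos A) * (gegenbauer k j).eval (Real.cos B) /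
        (gegenbauer k j).eval 1 =
      ∑ i ∈ range (j + 1), poch k i * poch k i / (poch (2 * k) i * (i.factorial : ℝ)) *
        (-4 * Real.sin A * Real.sin B) ^ i *
          (gegenbauer (k + i) (j - i)).eval (Real.cos (A - B)) := by
  have h1 := (gegenbauer_eval_one_pos hk j).ne'
  have hterm : ∀ i ∈ range (j + 1), productTerm k (gegenbauer k j) B i A =
      poch k i * poch k i / (poch (2 * k) i * (i.factorial : ℝ)) *
        (-4 * Real.sin A * Real.sin B) ^ i *
          (gegenbauer (k + i) (j - i)).eval (Real.cos (A - B)) := by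
    intro i hi
    obtain ⟨d, rfl⟩ := Nat.exists_eq_add_of_le (Nat.lt_succ_iff.1 (mem_range.1 hi))
    rw [productTerm, iterate_derivative_gegenbauer, Nat.add_sub_cancel_left, eval_mul, eval_C,
      show -4 * Real.sin A * Real.sin B = 2 * ((-2 * Real.sin B) * Real.sin A) by ring, mul_pow,
      mul_pow]
    ring
  rw [← sum_congr rfl hterm]
  -- Uniqueness requires a positive eigenvalue, which fails for `j = 0`.
  rcases Nat.eq_zero_or_pos j with rfl | hj
  · simp [productTerm]
  have hsol := (isTrigSol_sum_productTerm hk (isGegenbauerSol_gegenbauer k j) B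
    (iterate_derivative_gegenbauer_eq_zero k (Nat.lt_succ_self j))).sub
    ((isTrigSol_eval_cos (isGegenbauerSol_gegenbauer k j)).const_mul
      ((gegenbauer k j).eval (Real.cos B) / (gegenbauer k j).eval 1))
  have han : ∀ (P : ℝ[X]) (B : ℝ), AnalyticOnNhd ℝ (fun A => P.eval (Real.cos (A - B))) Set.univ :=
    fun P B A _ => by
      have : AnalyticAt ℝ (fun A => Real.cos (A - B)) A :=
        Real.analyticAt_cos.comp (analyticAt_id.sub analyticAt_const)
      simpa using this.aeval_polynomial P
  have hzero := hsol.eq_zero hk (by positivity) (by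
    refine AnalyticOnNhd.sub (Finset.analyticOnNhd_fun_sum _ fun i _ => ?_)
      (analyticOnNhd_const.mul (by simpa using han (gegenbauer k j) 0))
    exact analyticOnNhd_const.mul
      (AnalyticOnNhd.mul (fun A _ => Real.analyticAt_sin.pow i) (han _ B))) (by
    rw [sum_range_succ']
    simp [productTerm, h1]) A
  linear_combination -hzero

end ProductFormula

open Finset

/-! ### The product over the rotated angles. -/

section Trigonometry

open Complex in
lemma prod_sub_exp_mul {n : ℕ} (hn : n ≠ 0) (y : ℂ) :
    ∏ s : Fin n, (1 - exp (2 * Real.pi * I / n) ^ ((s : ℕ) + 1) * y) = 1 - y ^ n := by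
  have hζ := Complex.isPrimitiveRoot_exp n hn
  have h := hζ.pow_sub_pow_eq_prod_sub_mul 1 y (Nat.pos_of_ne_zero hn)
  rw [one_pow] at h
  have hinj : Function.Injective
      (fun s : Fin n => exp (2 * Real.pi * I / n) ^ ((s : ℕ) + 1)) := by
    intro s t hst
    simp only [pow_succ] at hst
    exact Fin.ext (hζ.pow_inj s.2 t.2 (mul_right_cancel₀ (Complex.exp_ne_zero _) hst))
  have himage : Polynomial.nthRootsFinset n (1 : ℂ) =
      univ.image (fun s : Fin n => exp (2 * Real.pi * I / n) ^ ((s : ℕ) + 1)) := by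
    symm
    refine eq_of_subset_of_card_le (fun z hz => ?_) ?_
    · obtain ⟨s, -, rfl⟩ := mem_image.1 hz
      rw [Polynomial.mem_nthRootsFinset (Nat.pos_of_ne_zero hn), pow_right_comm,
        hζ.pow_eq_one, one_pow]
    · rw [hζ.card_nthRootsFinset, card_image_of_injective _ hinj, card_univ, Fintype.card_fin]
  rw [h, himage, prod_image fun s _ t _ hst => hinj hst]

open Complex in
-- Each quadratic splits into a linear factor and its conjugate; the linear factors run over all
-- `n`-th roots of unity.
lemma prod_one_sub_two_mul_b {n : ℕ} (hn : n ≠ 0) (α z : ℝ) :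
    ∏ s : Fin n, (1 - 2 * b α n (s + 1) * z + z ^ 2) =
      1 - 2 * Real.cos (n * α) * z ^ n + (z ^ n) ^ 2 := by
  have hfac : ∀ β w : ℝ, ((1 - 2 * Real.cos β * w + w ^ 2 : ℝ) : ℂ) =
      (1 - exp (β * I) * w) * (1 - exp (-(β * I)) * w) := by
    intro β w
    have h1 : exp (β * I) * exp (-(β * I)) = 1 := by rw [← Complex.exp_add]; simp
    push_cast
    rw [Complex.cos, neg_mul]
    linear_combination (-(w : ℂ) ^ 2) * h1
  have hexp : ∀ s : Fin n, exp (((α + 2 * Real.pi * ((s + 1 : ℕ) : ℝ) / n : ℝ) : ℂ) * I) =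
      exp (2 * Real.pi * I / n) ^ ((s : ℕ) + 1) * exp (α * I) := by
    intro s
    rw [← Complex.exp_nat_mul, ← Complex.exp_add]
    congr 1
    push_cast
    ring
  have hA := prod_sub_exp_mul hn (exp (α * I) * z)
  rw [← Complex.ofReal_inj, Complex.ofReal_prod]
  have hstep : ∀ s : Fin n, ((1 - 2 * b α n (s + 1) * z + z ^ 2 : ℝ) : ℂ) =
      (1 - exp (2 * Real.pi * I / n) ^ ((s : ℕ) + 1) * (exp (α * I) * z)) *
      (starRingEnd ℂ) (1 - exp (2 * Real.pi * I / n) ^ ((s : ℕ) + 1) * (exp (α * I) * z)) := by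
    intro s
    rw [b, hfac, ← mul_assoc, ← hexp]
    congr 1
    rw [map_sub, map_mul, ← Complex.exp_conj, map_mul, Complex.conj_ofReal, Complex.conj_I,
      Complex.conj_ofReal, mul_neg, map_one]
  have hconj : (starRingEnd ℂ) (exp (α * I)) = exp (-(α * I)) := by
    rw [← Complex.exp_conj]; simp
  rw [prod_congr rfl fun s _ => hstep s, prod_mul_distrib, ← map_prod, hA, map_sub, map_one,
    map_pow, map_mul, hconj, Complex.conj_ofReal, mul_pow, mul_pow, ← Complex.exp_nat_mul,
    ← Complex.exp_nat_mul]
  have := hfac (n * α) (z ^ n)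
  push_cast at this ⊢
  rw [this]
  ring_nf

lemma prod_one_sub_two_mul_b_powerSeries {n : ℕ} (hn : n ≠ 0) (α : ℝ) (z : PowerSeries ℝ) :
    ∏ s : Fin n, (1 - PowerSeries.C (2 * b α n (s + 1)) * z + z ^ 2) =
      1 - PowerSeries.C (2 * Real.cos (n * α)) * z ^ n + (z ^ n) ^ 2 := by
  have h : ∏ s : Fin n, (1 - Polynomial.C (2 * b α n (s + 1)) * Polynomial.X + Polynomial.X ^ 2) =
      1 - Polynomial.C (2 * Real.cos (n * α)) * Polynomial.X ^ n + (Polynomial.X ^ n) ^ 2 := by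
    refine Polynomial.funext fun x => ?_
    simpa [Polynomial.eval_prod] using prod_one_sub_two_mul_b hn α x
  have := congrArg (Polynomial.aeval z) h
  simpa [map_prod] using this

end Trigonometry

/-! ### Powers of the Catalan series. -/

section Catalan

/-- The coefficients `a Γ(a + 2m) / (m! Γ(a + m + 1))` of the `a`-th power of the Catalan
series, as polynomials in `a`. -/
def catalanPowCoeff (a : ℝ) : ℕ → ℝ
  | 0 => 1
  | m + 1 => a * poch (a + m + 2) m / ((m + 1).factorial : ℝ)

lemma catalanPowCoeff_eq_Gamma {a : ℝ} (ha : 0 < a) (m : ℕ) :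
    catalanPowCoeff a m =
      a * Real.Gamma (a + 2 * m) / ((m.factorial : ℝ) * Real.Gamma (a + m + 1)) := by
  rcases m with _ | m
  · simp [catalanPowCoeff, Real.Gamma_add_one ha.ne', (mul_pos ha (Real.Gamma_pos_of_pos ha)).ne']
  · have hpos : 0 < a + m + 2 := by positivity
    have h := poch_mul_Gamma hpos m
    have hG := (Real.Gamma_pos_of_pos hpos).ne'
    rw [show a + 2 * ((m + 1 : ℕ) : ℝ) = a + m + 2 + m by push_cast; ring, ← h,
      show a + ((m + 1 : ℕ) : ℝ) + 1 = a + m + 2 by push_cast; ring, catalanPowCoeff]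
    field_simp

/-- This is the coefficient form of `c^(a+1) = c^a + X² c^(a+2)`. -/
lemma catalanPowCoeff_succ (a : ℝ) (m : ℕ) :
    catalanPowCoeff (a + 1) (m + 1) = catalanPowCoeff a (m + 1) + catalanPowCoeff (a + 2) m := by
  rcases m with _ | m
  · simp [catalanPowCoeff]
  · simp only [catalanPowCoeff]
    rw [poch_succ, poch_succ_left, Nat.factorial_succ (m + 1)]
    push_cast
    rw [show a + 1 + ((m : ℝ) + 1) + 2 = a + m + 4 by ring,
      show a + ((m : ℝ) + 1) + 2 + 1 = a + m + 4 by ring,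
      show a + 2 + (m : ℝ) + 2 = a + m + 4 by ring]
    field_simp
    ring

@[simp]
lemma catalanPowCoeff_zero_succ (m : ℕ) : catalanPowCoeff 0 (m + 1) = 0 := by
  simp [catalanPowCoeff]

lemma exists_catalan_sq : ∃ c : PowerSeries ℝ, c = 1 + PowerSeries.X ^ 2 * c ^ 2 := by
  have h := congrArg (fun f => PowerSeries.expand 2 two_ne_zero
    (PowerSeries.map (Nat.castRingHom ℝ) f)) PowerSeries.catalanSeries_sq_mul_X_add_one
  refine ⟨PowerSeries.expand 2 two_ne_zero
    (PowerSeries.map (Nat.castRingHom ℝ) PowerSeries.catalanSeries), ?_⟩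
  simp only [map_add, map_mul, map_pow, map_one, PowerSeries.map_X, PowerSeries.expand_X] at h
  linear_combination -h

lemma coeff_catalan_sq_pow {c : PowerSeries ℝ} (hc : c = 1 + PowerSeries.X ^ 2 * c ^ 2)
    (m a : ℕ) : PowerSeries.coeff (2 * m) (c ^ a) = catalanPowCoeff a m ∧
      PowerSeries.coeff (2 * m + 1) (c ^ a) = 0 := by
  have hrec : ∀ a : ℕ, c ^ (a + 1) = c ^ a + PowerSeries.X ^ 2 * c ^ (a + 2) := fun a => by
    linear_combination c ^ a * hc
  induction m generalizing a with
  | zero =>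
    induction a with
    | zero => simp [catalanPowCoeff, PowerSeries.coeff_one]
    | succ a ih =>
      rw [hrec, map_add, map_add, ih.1, ih.2, PowerSeries.coeff_X_pow_mul',
        PowerSeries.coeff_X_pow_mul']
      simp [catalanPowCoeff]
  | succ m ihm =>
    induction a with
    | zero => simp [PowerSeries.coeff_one]
    | succ a ih =>
      rw [hrec, map_add, map_add, ih.1, ih.2, show 2 * (m + 1) = 2 * m + 2 by ring,
        show 2 * m + 2 + 1 = 2 * m + 1 + 2 by ring, PowerSeries.coeff_X_pow_mul,
        PowerSeries.coeff_X_pow_mul, (ihm _).1, (ihm _).2]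
      push_cast
      exact ⟨(catalanPowCoeff_succ a m).symm, by simp⟩

end Catalan

/-! ### Generating functions, handled through recursion in the exponent. -/

section GeneratingFunctions

open PowerSeries

/-- The series `∑ (κ)_m / m! (yX)^m = (1 - yX)^(-κ)`. -/
def binomSeries (κ y : ℝ) : PowerSeries ℝ :=
  .mk fun m => poch κ m / (m.factorial : ℝ) * y ^ m

/-- The series `∑ C_l^{(κ)}(x) X^l = (1 - 2xX + X²)^(-κ)`. -/
def gegenbauerSeries (κ x : ℝ) : PowerSeries ℝ :=
  .mk fun l => (gegenbauer κ l).eval x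

lemma poch_zero_left (j : ℕ) : poch 0 (j + 1) = 0 := by rw [poch_succ_left, zero_mul]

lemma binomSeries_zero (y : ℝ) : binomSeries 0 y = 1 := by
  ext m
  rcases m with _ | m
  · simp [binomSeries]
  · simp [binomSeries, poch_zero_left, PowerSeries.coeff_one]

lemma gegenbauerSeries_zero (x : ℝ) : gegenbauerSeries 0 x = 1 := by
  ext l
  rcases l with _ | l
  · simp [gegenbauerSeries]
  · have : gegenbauer 0 (l + 1) = 0 := by
      rw [gegenbauer_eq_sum]
      refine sum_eq_zero fun i hi => ?_
      rw [mem_range] at hi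
      obtain ⟨d, hd⟩ : ∃ d, l + 1 - i = d + 1 := ⟨l - i, by omega⟩
      rw [gegenbauerCoeff, hd, poch_zero_left]
      simp
    simp [gegenbauerSeries, this, PowerSeries.coeff_one]

lemma one_sub_mul_binomSeries (κ y : ℝ) :
    (1 - C y * X) * binomSeries (κ + 1) y = binomSeries κ y := by
  ext m
  rw [sub_mul, one_mul, mul_assoc, map_sub, coeff_C_mul]
  rcases m with _ | m
  · simp [binomSeries]
  · simp only [coeff_succ_X_mul, binomSeries, coeff_mk]
    rw [poch_succ, poch_succ_left κ, Nat.factorial_succ]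
    push_cast
    field_simp
    ring

/-- The summand of the Gegenbauer polynomial evaluated at `y / 2`, extended by zero. -/
def gegenbauerTerm (κ y : ℝ) (j l : ℕ) : ℝ :=
  if 2 * l ≤ j then gegenbauerCoeff κ j l * y ^ (j - 2 * l) else 0

lemma eval_gegenbauer_eq_sum_gegenbauerTerm (κ x : ℝ) {j L : ℕ} (hL : j / 2 < L) :
    (gegenbauer κ j).eval x = ∑ l ∈ range L, gegenbauerTerm κ (2 * x) j l := by
  rw [gegenbauer_eq_sum, Polynomial.eval_finsetSum]
  rw [← sum_subset (range_subset_range.2 (show j / 2 + 1 ≤ L by omega))]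
  · refine sum_congr rfl fun l hl => ?_
    rw [mem_range] at hl
    rw [gegenbauerTerm, if_pos (by omega)]
    simp
  · intro l _ hl
    rw [mem_range] at hl
    rw [gegenbauerTerm, if_neg (by omega)]

lemma gegenbauerTerm_two_mul_add (κ y : ℝ) (l r : ℕ) :
    gegenbauerTerm κ y (2 * l + r) l =
      (-1) ^ l * poch κ (l + r) / ((l.factorial : ℝ) * (r.factorial : ℝ)) * y ^ r := by
  rw [gegenbauerTerm, if_pos (by omega), gegenbauerCoeff_two_mul_add, Nat.add_sub_cancel_left]

lemma gegenbauerTerm_of_lt (κ y : ℝ) {j l : ℕ} (h : j < 2 * l) : gegenbauerTerm κ y j l = 0 :=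
  if_neg (by omega)

lemma gegenbauerTerm_zero_rec (κ y : ℝ) (j : ℕ) :
    gegenbauerTerm (κ + 1) y (j + 1) 0 - y * gegenbauerTerm (κ + 1) y j 0 =
      gegenbauerTerm κ y (j + 1) 0 := by
  have h := fun κ j => gegenbauerTerm_two_mul_add κ y 0 j
  simp only [mul_zero, zero_add] at h
  rw [h, h, h, poch_succ, poch_succ_left κ, Nat.factorial_succ, pow_succ]
  push_cast
  field_simp
  ring

/-- Termwise form of multiplication by `1 - yX + X²`: the `X²` contribution pairs with the summation
index shifted by one. -/
lemma gegenbauerTerm_succ_rec (κ y : ℝ) (j l : ℕ) :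
    gegenbauerTerm (κ + 1) y (j + 2) (l + 1) - y * gegenbauerTerm (κ + 1) y (j + 1) (l + 1) +
      gegenbauerTerm (κ + 1) y j l = gegenbauerTerm κ y (j + 2) (l + 1) := by
  rcases lt_or_ge j (2 * l) with h | h
  · simp only [gegenbauerTerm_of_lt _ _ h,
      gegenbauerTerm_of_lt _ _ (show j + 2 < 2 * (l + 1) by omega),
      gegenbauerTerm_of_lt _ _ (show j + 1 < 2 * (l + 1) by omega)]
    simp
  · obtain ⟨r, rfl⟩ := Nat.exists_eq_add_of_le h
    rw [show 2 * l + r + 2 = 2 * (l + 1) + r by ring, gegenbauerTerm_two_mul_add,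
      gegenbauerTerm_two_mul_add, gegenbauerTerm_two_mul_add]
    rcases r with _ | r
    · rw [gegenbauerTerm_of_lt _ _ (by omega), add_zero, add_zero, poch_succ, poch_succ_left κ,
        Nat.factorial_succ]
      push_cast
      field_simp
      ring
    · rw [show 2 * l + (r + 1) + 1 = 2 * (l + 1) + r by ring, gegenbauerTerm_two_mul_add,
        show l + 1 + (r + 1) = l + r + 1 + 1 by ring, show l + 1 + r = l + r + 1 by ring,
        show l + (r + 1) = l + r + 1 by ring, poch_succ _ (l + r + 1), poch_succ_left κ,
        Nat.factorial_succ, Nat.factorial_succ, pow_succ y]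
      push_cast
      field_simp
      ring

lemma mul_gegenbauerSeries (κ x : ℝ) :
    (1 - C (2 * x) * X + X ^ 2) * gegenbauerSeries (κ + 1) x = gegenbauerSeries κ x := by
  ext m
  rw [add_mul, sub_mul, one_mul, mul_assoc, map_add, map_sub, coeff_C_mul]
  rcases m with _ | _ | j
  · simp [gegenbauerSeries, PowerSeries.coeff_X_pow_mul']
  · simp only [coeff_succ_X_mul, PowerSeries.coeff_X_pow_mul', gegenbauerSeries, coeff_mk]
    simp only [zero_add]
    rw [eval_gegenbauer_eq_sum_gegenbauerTerm _ _ (show 1 / 2 < 1 by norm_num),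
      eval_gegenbauer_eq_sum_gegenbauerTerm _ _ (show 0 / 2 < 1 by norm_num),
      eval_gegenbauer_eq_sum_gegenbauerTerm _ _ (show 1 / 2 < 1 by norm_num)]
    simpa using gegenbauerTerm_zero_rec κ (2 * x) 0
  · rw [coeff_succ_X_mul, add_assoc j 1 1, one_add_one_eq_two, PowerSeries.coeff_X_pow_mul]
    simp only [gegenbauerSeries, coeff_mk]
    rw [eval_gegenbauer_eq_sum_gegenbauerTerm _ _ (show (j + 2) / 2 < j + 2 by omega),
      eval_gegenbauer_eq_sum_gegenbauerTerm _ _ (show (j + 1) / 2 < j + 2 by omega),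
      eval_gegenbauer_eq_sum_gegenbauerTerm _ _ (show j / 2 < j + 1 by omega),
      eval_gegenbauer_eq_sum_gegenbauerTerm _ _ (show (j + 2) / 2 < j + 2 by omega),
      sum_range_succ', sum_range_succ' _ (j + 1), sum_range_succ' _ (j + 1),
      ← gegenbauerTerm_zero_rec κ, ← sum_congr rfl fun l _ => gegenbauerTerm_succ_rec κ (2 * x) j l,
      sum_add_distrib, sum_sub_distrib, ← mul_sum]
    ring

/-- Since `X` divides `W`, the terms `W ^ l` with `l > N` do not reach degree `N`, so `H` may be
truncated. -/
lemma coeff_mul_subst {W : PowerSeries ℝ} (hW : X ∣ W) (f H : PowerSeries ℝ) (N : ℕ) :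
    coeff N (f * H.subst W) = ∑ l ∈ range (N + 1), coeff l H * coeff N (f * W ^ l) := by
  have hs : HasSubst W := HasSubst.of_constantCoeff_zero' (X_dvd_iff.1 hW)
  have hdvd : X ^ (N + 1) ∣
      f * (W ^ (N + 1) * (PowerSeries.mk fun i => coeff (i + (N + 1)) H).subst W) :=
    ((pow_dvd_pow_of_dvd hW _).mul_right _).mul_left _
  have h0 := X_pow_dvd_iff.1 hdvd N (Nat.lt_succ_self N)
  conv_lhs => rw [eq_X_pow_mul_shift_add_trunc (N + 1) H]
  rw [subst_add hs, subst_mul hs, subst_pow hs, subst_X hs, mul_add, map_add, h0, zero_add,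
    subst_coe hs, trunc_apply, map_sum, mul_sum, map_sum, Nat.Ico_zero_eq_range]
  refine sum_congr rfl fun l _ => ?_
  rw [Polynomial.aeval_monomial, mul_left_comm, PowerSeries.algebraMap_apply, coeff_C_mul]
  simp

end GeneratingFunctions

/-! ### Expanding the product of binomial series in Gegenbauer polynomials. -/

section Expansion

open PowerSeries

/-- For natural `κ`, induction avoids real powers of series: multiplying by `Q` lowers the exponent
by one on both sides, and `Q` can be cancelled. -/
lemma prod_binomSeries_natCast {n : ℕ} (hn : n ≠ 0) (α : ℝ) {c : PowerSeries ℝ}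
    (hc : c = 1 + X ^ 2 * c ^ 2) (κ : ℕ) :
    ∏ s : Fin n, binomSeries κ (2 * b α n (s + 1)) =
      c ^ (n * κ) * (gegenbauerSeries κ (Real.cos (n * α))).subst ((X * c) ^ n) := by
  have hs : HasSubst ((X * c) ^ n) :=
    HasSubst.of_constantCoeff_zero' (by simp [hn])
  set W := (X * c) ^ n with hW
  set Q : PowerSeries ℝ := ∏ s : Fin n, (1 - C (2 * b α n (s + 1)) * X) with hQ
  have hQ0 : Q ≠ 0 := by
    intro h
    have := congrArg constantCoeff h
    simp [hQ, map_prod] at this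
  have hQc : Q * c ^ n = 1 - C (2 * Real.cos (n * α)) * W + W ^ 2 := by
    rw [← prod_one_sub_two_mul_b_powerSeries hn, hQ,
      show c ^ n = ∏ _s : Fin n, c by simp, ← prod_mul_distrib]
    refine prod_congr rfl fun s _ => ?_
    linear_combination hc
  induction κ with
  | zero =>
    simp only [Nat.cast_zero, binomSeries_zero, gegenbauerSeries_zero, mul_zero, pow_zero, one_mul,
      prod_const_one]
    rw [← coe_substAlgHom hs, map_one]
  | succ κ ih =>
    refine mul_left_cancel₀ hQ0 ?_
    have hl : Q * ∏ s : Fin n, binomSeries ((κ + 1 : ℕ) : ℝ) (2 * b α n (s + 1)) =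
        ∏ s : Fin n, binomSeries κ (2 * b α n (s + 1)) := by
      rw [hQ, ← prod_mul_distrib]
      push_cast
      exact prod_congr rfl fun s _ => one_sub_mul_binomSeries κ _
    have hr := congrArg (substAlgHom hs) (mul_gegenbauerSeries κ (Real.cos (n * α)))
    have hC : substAlgHom hs (C (2 * Real.cos (n * α))) = C (2 * Real.cos (n * α)) :=
      (substAlgHom hs).commutes (2 * Real.cos (n * α))
    rw [map_mul, map_add, map_sub, map_mul, map_pow, map_one, substAlgHom_X, hC,
      coe_substAlgHom, ← hQc] at hr
    rw [hl, ih, ← hr, Nat.cast_succ]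
    ring

lemma mem_indexPairs {N n : ℕ} (hn : n ≠ 0) {p : ℕ × ℕ} :
    p ∈ indexPairs N n ↔ 2 * p.2 + n * p.1 = N := by
  have := Nat.le_mul_of_pos_left p.1 (Nat.pos_of_ne_zero hn)
  simp only [indexPairs, mem_filter, mem_product, mem_range]
  omega

lemma coeff_catalan_sq_pow_mul_subst {n : ℕ} (hn : n ≠ 0) {c : PowerSeries ℝ}
    (hc : c = 1 + X ^ 2 * c ^ 2) (κ : ℕ) (H : PowerSeries ℝ) (N : ℕ) :
    coeff N (c ^ (n * κ) * H.subst ((X * c) ^ n)) =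
      ∑ p ∈ indexPairs N n, catalanPowCoeff (n * (p.1 + κ)) p.2 * coeff p.1 H := by
  rw [coeff_mul_subst (dvd_pow (dvd_mul_right X c) hn), indexPairs, sum_filter, sum_product]
  refine sum_congr rfl fun l _ => ?_
  have hpow : c ^ (n * κ) * ((X * c) ^ n) ^ l = X ^ (n * l) * c ^ (n * (l + κ)) := by ring
  rw [hpow, coeff_X_pow_mul']
  dsimp only
  split_ifs with hl
  · obtain ⟨d, rfl⟩ := Nat.exists_eq_add_of_le hl
    rw [Nat.add_sub_cancel_left]
    rcases Nat.even_or_odd' d with ⟨m, rfl | rfl⟩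
    · rw [(coeff_catalan_sq_pow hc m _).1, sum_eq_single m]
      · rw [if_pos (by ring)]
        push_cast
        ring
      · intro m' _ hm'
        rw [if_neg (by omega)]
      · intro h
        rw [mem_range] at h
        omega
    · rw [(coeff_catalan_sq_pow hc m _).2, mul_zero]
      exact (sum_eq_zero fun m' _ => if_neg (by omega)).symm
  · rw [mul_zero]
    exact (sum_eq_zero fun m' _ => if_neg (by omega)).symm

lemma coeff_prod_eq_sum_piAntidiag {ι : Type*} [Fintype ι] [DecidableEq ι]
    (f : ι → PowerSeries ℝ) (N : ℕ) :
    coeff N (∏ s, f s) = ∑ m ∈ piAntidiag univ N, ∏ s, coeff (m s) (f s) := by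
  rw [PowerSeries.coeff_prod]
  refine sum_nbij' (fun l => ⇑l) (fun m => Finsupp.equivFunOnFinite.symm m) ?_ ?_ ?_ ?_ ?_
  · intro l hl
    rw [mem_finsuppAntidiag] at hl
    simpa using hl.1
  · intro m hm
    rw [mem_piAntidiag] at hm
    simpa [mem_finsuppAntidiag] using hm.1
  · intro l _
    ext
    simp
  · intro m _
    ext
    simp
  · intro l _
    rfl

/-- Functions of one real variable given by a polynomial. -/
def IsPolynomialFun (f : ℝ → ℝ) : Prop := ∃ p : Polynomial ℝ, ∀ x, f x = p.eval x

namespace IsPolynomialFun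

lemma const (a : ℝ) : IsPolynomialFun fun _ => a := ⟨Polynomial.C a, by simp⟩

lemma mul {f g : ℝ → ℝ} (hf : IsPolynomialFun f) (hg : IsPolynomialFun g) :
    IsPolynomialFun fun x => f x * g x := by
  obtain ⟨p, hp⟩ := hf
  obtain ⟨q, hq⟩ := hg
  exact ⟨p * q, fun x => by simp [hp, hq]⟩

lemma sum {ι : Type*} (s : Finset ι) {f : ι → ℝ → ℝ} (hf : ∀ i, IsPolynomialFun (f i)) :
    IsPolynomialFun fun x => ∑ i ∈ s, f i x := by
  choose p hp using hf
  exact ⟨∑ i ∈ s, p i, fun x => by simp [hp, Polynomial.eval_finsetSum]⟩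

lemma prod {ι : Type*} (s : Finset ι) {f : ι → ℝ → ℝ} (hf : ∀ i, IsPolynomialFun (f i)) :
    IsPolynomialFun fun x => ∏ i ∈ s, f i x := by
  choose p hp using hf
  exact ⟨∏ i ∈ s, p i, fun x => by simp [hp, Polynomial.eval_prod]⟩

lemma poch (j : ℕ) : IsPolynomialFun fun x => poch x j := ⟨ascPochhammer ℝ j, fun _ => rfl⟩

lemma comp_affine {f : ℝ → ℝ} (hf : IsPolynomialFun f) (u v : ℝ) :
    IsPolynomialFun fun x => f (u * (v + x)) := by
  obtain ⟨p, hp⟩ := hf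
  exact ⟨p.comp (Polynomial.C u * (Polynomial.C v + Polynomial.X)), fun x => by simp [hp]⟩

lemma catalanPowCoeff (m : ℕ) : IsPolynomialFun fun a => catalanPowCoeff a m := by
  rcases m with _ | m
  · exact const 1
  · refine ⟨Polynomial.X * (ascPochhammer ℝ m).comp (Polynomial.X + Polynomial.C (m + 2 : ℝ)) *
      Polynomial.C (((m + 1).factorial : ℝ)⁻¹), fun x => ?_⟩
    simp only [DihedralGegenbauer.catalanPowCoeff, DihedralGegenbauer.poch, Polynomial.eval_mul,
      Polynomial.eval_comp, Polynomial.eval_add, Polynomial.eval_X, Polynomial.eval_C,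
      div_eq_mul_inv, add_assoc]

lemma eval_gegenbauer (l : ℕ) (y : ℝ) : IsPolynomialFun fun κ => (gegenbauer κ l).eval y := by
  simp only [gegenbauer, Polynomial.eval_finsetSum, Polynomial.eval_mul, Polynomial.eval_C,
    div_eq_mul_inv]
  exact sum _ fun i => (((const _).mul (poch _)).mul (const _)).mul (const _)

lemma eq_of_natCast {f g : ℝ → ℝ} (hf : IsPolynomialFun f) (hg : IsPolynomialFun g)
    (h : ∀ κ : ℕ, f κ = g κ) (x : ℝ) : f x = g x := by
  obtain ⟨p, hp⟩ := hf
  obtain ⟨q, hq⟩ := hg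
  have : p = q := by
    refine Polynomial.eq_of_infinite_eval_eq p q
      ((Set.infinite_range_of_injective (Nat.cast_injective (R := ℝ))).mono ?_)
    rintro _ ⟨κ, rfl⟩
    simpa [hp, hq] using h κ
  rw [hp, hq, this]

end IsPolynomialFun

/-- Expansion of the coefficients of `∏ₛ (1 - 2 bₛ X)^(-κ)` in Gegenbauer polynomials. -/
theorem sum_piAntidiag_eq_sum_indexPairs {n : ℕ} (hn : n ≠ 0) (α κ : ℝ) (N : ℕ) :
    ∑ m ∈ piAntidiag (univ : Finset (Fin n)) N,
        ∏ s, poch κ (m s) / ((m s).factorial : ℝ) * (2 * b α n (s + 1)) ^ m s =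
      ∑ p ∈ indexPairs N n, catalanPowCoeff (n * (p.1 + κ)) p.2 *
        (gegenbauer κ p.1).eval (Real.cos (n * α)) := by
  revert κ
  -- For fixed `N` both sides are polynomial in `κ`, so natural values suffice.
  refine IsPolynomialFun.eq_of_natCast ?_ ?_ fun κ => ?_
  · simp only [div_eq_mul_inv]
    exact .sum _ fun m => .prod _ fun s => ((IsPolynomialFun.poch _).mul (.const _)).mul (.const _)
  · exact .sum _ fun p => ((IsPolynomialFun.catalanPowCoeff p.2).comp_affine n p.1).mul
      (.eval_gegenbauer p.1 _)
  · obtain ⟨c, hc⟩ := exists_catalan_sq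
    have h := congrArg (coeff N) (prod_binomSeries_natCast hn α hc κ)
    rw [coeff_catalan_sq_pow_mul_subst hn hc, coeff_prod_eq_sum_piAntidiag] at h
    simpa only [binomSeries, gegenbauerSeries, coeff_mk] using h

end Expansion

/-! ### Interchanging the summations. -/

section Reindexing

/-- Subtracting `j` from every entry is a bijection: `j` is at most the minimum, so no truncation
occurs, and the total drops by `n * j`. -/
lemma sum_piAntidiag_sum_range_iInf {n : ℕ} (hn : n ≠ 0) (N : ℕ) (f : ℕ → (Fin n → ℕ) → ℝ) :
    ∑ m ∈ piAntidiag (univ : Finset (Fin n)) N, ∑ j ∈ range ((⨅ s, m s) + 1),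
        f j (fun s => m s - j) =
      ∑ j ∈ range (N + 1) with n * j ≤ N, ∑ m ∈ piAntidiag (univ : Finset (Fin n)) (N - n * j),
        f j m := by
  have : Nonempty (Fin n) := ⟨⟨0, Nat.pos_of_ne_zero hn⟩⟩
  have hinf : ∀ (m : Fin n → ℕ) j, j < (⨅ s, m s) + 1 ↔ ∀ s, j ≤ m s := fun m j => by
    rw [Nat.lt_succ_iff, le_ciInf_iff (OrderBot.bddBelow _)]
  rw [sum_sigma', sum_sigma']
  refine sum_nbij' (fun x => ⟨x.2, fun s => x.1 s - x.2⟩) (fun x => ⟨fun s => x.2 s + x.1, x.1⟩)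
    ?_ ?_ ?_ ?_ ?_
  · rintro ⟨m, j⟩ h
    simp only [mem_sigma, mem_piAntidiag, mem_univ, implies_true, and_true, mem_range, hinf,
      mem_filter] at h ⊢
    obtain ⟨h1, h2⟩ := h
    have hsum : ∑ s, (m s - j) + n * j = N := by
      have hconst : n * j = ∑ _s : Fin n, j := by simp
      rw [← h1, hconst, ← sum_add_distrib]
      exact sum_congr rfl fun s _ => Nat.sub_add_cancel (h2 s)
    have := Nat.le_mul_of_pos_left j (Nat.pos_of_ne_zero hn)
    omega
  · rintro ⟨j, m⟩ h
    simp only [mem_sigma, mem_piAntidiag, mem_univ, implies_true, and_true, mem_range, hinf,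
      mem_filter] at h ⊢
    refine ⟨?_, fun s => Nat.le_add_left _ _⟩
    rw [sum_add_distrib, sum_const, card_univ, Fintype.card_fin, smul_eq_mul, h.2,
      Nat.sub_add_cancel h.1.2]
  · rintro ⟨m, j⟩ h
    simp only [mem_sigma, mem_range, hinf] at h
    simp only [Sigma.mk.injEq, heq_eq_eq, and_true]
    exact funext fun s => Nat.sub_add_cancel (h.2 s)
  · rintro ⟨j, m⟩ _
    simp
  · rintro ⟨m, j⟩ _
    rfl

lemma sum_range_sum_indexPairs {n : ℕ} (hn : n ≠ 0) (N : ℕ) (f : ℕ → ℕ → ℕ → ℝ) :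
    ∑ j ∈ range (N + 1) with n * j ≤ N, ∑ p ∈ indexPairs (N - n * j) n, f j p.1 p.2 =
      ∑ p ∈ indexPairs N n, ∑ j ∈ range (p.1 + 1), f j (p.1 - j) p.2 := by
  rw [sum_sigma', sum_sigma']
  refine sum_nbij' (fun x => ⟨(x.2.1 + x.1, x.2.2), x.1⟩) (fun x => ⟨x.2, (x.1.1 - x.2, x.1.2)⟩)
    ?_ ?_ ?_ ?_ ?_
  · rintro ⟨j, l, m⟩ h
    simp only [mem_sigma, mem_indexPairs hn, mem_range, mem_filter, mul_add] at h ⊢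
    omega
  · rintro ⟨⟨l, m⟩, j⟩ h
    simp only [mem_sigma, mem_indexPairs hn, mem_range, mem_filter] at h ⊢
    obtain ⟨d, rfl⟩ := Nat.exists_eq_add_of_le (Nat.lt_succ_iff.1 h.2)
    rw [Nat.add_sub_cancel_left]
    have := Nat.le_mul_of_pos_left j (Nat.pos_of_ne_zero hn)
    have h1 := h.1
    rw [mul_add] at h1
    omega
  · rintro ⟨j, l, m⟩ _
    simp
  · rintro ⟨⟨l, m⟩, j⟩ h
    simp only [mem_sigma, mem_range] at h
    simp
    omega
  · rintro ⟨j, l, m⟩ _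
    simp

end Reindexing

/-! ### Assembling the formula. -/

/-- With `a = n(j + k)` the constraint `2m + nj = N` makes `a + 2m` equal to `nk + N`, so the
numerator `Γ(a + 2m)` is constant and factors out. -/
lemma S_eq_sum_catalanPowCoeff {n : ℕ} (hn : n ≠ 0) {k : ℝ} (hk : 0 < k) (φ θ : ℝ) (N : ℕ) :
    S N n k φ θ = (Real.Gamma (n * k + N))⁻¹ * ∑ p ∈ indexPairs N n,
      catalanPowCoeff (n * (p.1 + k)) p.2 *
        ((gegenbauer k p.1).eval (Real.cos (n * φ)) * (gegenbauer k p.1).eval (Real.cos (n * θ)) /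
          (gegenbauer k p.1).eval 1) := by
  rw [S, mul_sum]
  refine sum_congr rfl fun p hp => ?_
  rw [mem_indexPairs hn] at hp
  have hn' : (0 : ℝ) < n := by exact_mod_cast Nat.pos_of_ne_zero hn
  have hG : Real.Gamma (n * k + N) ≠ 0 := (Real.Gamma_pos_of_pos (by positivity)).ne'
  have hN : (n : ℝ) * (p.1 + k) + 2 * p.2 = n * k + N := by
    rw [← hp]
    push_cast
    ring
  rw [catalanPowCoeff_eq_Gamma (by positivity), hN, ← mul_assoc]
  congr 1
  field_simp

lemma two_pow_mul_sum_piAntidiag {n : ℕ} (hn : n ≠ 0) (α κ : ℝ) (N : ℕ) :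
    2 ^ N * ∑ m ∈ piAntidiag (univ : Finset (Fin n)) N,
        ∏ s, poch κ (m s) / ((m s).factorial : ℝ) * b α n (s + 1) ^ m s =
      ∑ p ∈ indexPairs N n, catalanPowCoeff (n * (p.1 + κ)) p.2 *
        (gegenbauer κ p.1).eval (Real.cos (n * α)) := by
  rw [← sum_piAntidiag_eq_sum_indexPairs hn, mul_sum]
  refine sum_congr rfl fun m hm => ?_
  rw [mem_piAntidiag] at hm
  rw [← hm.1, ← prod_pow_eq_pow_sum, ← prod_mul_distrib]
  refine prod_congr rfl fun s _ => ?_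
  rw [mul_pow]
  ring

theorem S_eq {n : ℕ} (hn : n ≠ 0) {k : ℝ} (hk : 0 < k) (φ θ : ℝ) (N : ℕ) :
    S N n k φ θ = 2 ^ N / Real.Gamma (n * k + N) *
      ∑ m ∈ piAntidiag (univ : Finset (Fin n)) N, ∑ j ∈ range ((⨅ s, m s) + 1),
        poch k j * poch k j / (poch (2 * k) j * (j.factorial : ℝ)) *
          (-(2 : ℝ) ^ (2 - (n : ℤ)) * Real.sin (n * θ) * Real.sin (n * φ)) ^ j *
          ∏ s : Fin n, poch (k + j) (m s - j) / ((m s - j).factorial : ℝ) *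
            b (θ - φ) n (s + 1) ^ (m s - j) := by
  rw [sum_piAntidiag_sum_range_iInf hn N fun j m =>
    poch k j * poch k j / (poch (2 * k) j * (j.factorial : ℝ)) *
      (-(2 : ℝ) ^ (2 - (n : ℤ)) * Real.sin (n * θ) * Real.sin (n * φ)) ^ j *
      ∏ s : Fin n, poch (k + j) (m s) / ((m s).factorial : ℝ) * b (θ - φ) n (s + 1) ^ m s]
  rw [S_eq_sum_catalanPowCoeff hn hk, div_eq_inv_mul, mul_assoc]
  congr 1
  have hinner : ∀ j ∈ {j ∈ range (N + 1) | n * j ≤ N},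
      2 ^ N * ∑ m ∈ piAntidiag (univ : Finset (Fin n)) (N - n * j),
        poch k j * poch k j / (poch (2 * k) j * (j.factorial : ℝ)) *
          (-(2 : ℝ) ^ (2 - (n : ℤ)) * Real.sin (n * θ) * Real.sin (n * φ)) ^ j *
          ∏ s : Fin n, poch (k + j) (m s) / ((m s).factorial : ℝ) * b (θ - φ) n (s + 1) ^ m s =
      ∑ p ∈ indexPairs (N - n * j) n,
        poch k j * poch k j / (poch (2 * k) j * (j.factorial : ℝ)) *
          (-4 * Real.sin (n * θ) * Real.sin (n * φ)) ^ j *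
          (catalanPowCoeff (n * (p.1 + (k + j))) p.2 *
            (gegenbauer (k + j) p.1).eval (Real.cos (n * (θ - φ)))) := by
    intro j hj
    rw [← mul_sum, ← mul_sum, ← two_pow_mul_sum_piAntidiag hn]
    have hpow : (2 : ℝ) ^ N = 2 ^ (N - n * j) * ((2 : ℝ) ^ n) ^ j := by
      rw [← pow_mul, ← pow_add, Nat.sub_add_cancel (mem_filter.1 hj).2]
    -- The inner sum absorbs only `2 ^ (N - n * j)`; the remaining `2 ^ (n * j)` turns `-2^(2-n)`
    -- into the `-4` of the product formula.
    have h4 : (-4 * Real.sin (n * θ) * Real.sin (n * φ)) ^ j = ((2 : ℝ) ^ n) ^ j *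
        (-(2 : ℝ) ^ (2 - (n : ℤ)) * Real.sin (n * θ) * Real.sin (n * φ)) ^ j := by
      rw [← mul_pow, zpow_sub₀ two_ne_zero, zpow_natCast]
      congr 1
      field_simp
      ring
    rw [hpow, h4]
    ring
  rw [mul_sum, sum_congr rfl hinner, sum_range_sum_indexPairs hn N fun j l m =>
    poch k j * poch k j / (poch (2 * k) j * (j.factorial : ℝ)) *
      (-4 * Real.sin (n * θ) * Real.sin (n * φ)) ^ j *
      (catalanPowCoeff (n * (l + (k + j))) m *
        (gegenbauer (k + j) l).eval (Real.cos (n * (θ - φ))))]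
  refine sum_congr rfl fun p _ => ?_
  rw [mul_comm ((gegenbauer k p.1).eval _), gegenbauer_mul_gegenbauer hk, mul_sum]
  refine sum_congr rfl fun j hj => ?_
  rw [Nat.cast_sub (Nat.lt_succ_iff.1 (mem_range.1 hj)), mul_sub,
    show (p.1 : ℝ) - j + (k + j) = p.1 + k by ring]
  ring

/-- At `φ = 0` one Gegenbauer factor cancels the normalization, so the single-factor expansion
applies directly. -/
theorem S_zero_eq {n : ℕ} (hn : n ≠ 0) {k : ℝ} (hk : 0 < k) (θ : ℝ) (N : ℕ) :
    S N n k 0 θ = 2 ^ N / Real.Gamma (n * k + N) *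
      ∑ m ∈ piAntidiag (univ : Finset (Fin n)) N,
        ∏ s : Fin n, poch k (m s) * (b θ n (s + 1) ^ m s / ((m s).factorial : ℝ)) := by
  have h := two_pow_mul_sum_piAntidiag hn θ k N
  simp only [div_mul_eq_mul_div, mul_div_assoc] at h
  rw [S_eq_sum_catalanPowCoeff hn hk, div_eq_inv_mul, mul_assoc, h]
  congr 1
  refine sum_congr rfl fun p _ => ?_
  rw [mul_zero, Real.cos_zero, mul_div_cancel_left₀ _ (gegenbauer_eval_one_pos hk p.1).ne']

end DihedralGegenbauer

end

theorem theorem1 (n : ℕ) (hn : 1 ≤ n) (k : ℝ) (hk : 0 < k) (φ θ : ℝ) (N : ℕ) :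
    DihedralGegenbauer.S N n k φ θ =
        2 ^ N / Real.Gamma ((n : ℝ) * k + (N : ℝ)) *
          ∑ m ∈ Finset.piAntidiag (Finset.univ : Finset (Fin n)) N,
            ∑ j ∈ Finset.range ((⨅ s, m s) + 1),
              DihedralGegenbauer.poch k j * DihedralGegenbauer.poch k j /
                  (DihedralGegenbauer.poch (2 * k) j * (j.factorial : ℝ)) *
                (-(2 : ℝ) ^ (2 - (n : ℤ)) * Real.sin (n * θ) * Real.sin (n * φ)) ^ j *
                ∏ s : Fin n,
                  DihedralGegenbauer.poch (k + j) (m s - j) / ((m s - j).factorial : ℝ) *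
                    DihedralGegenbauer.b (θ - φ) n (s + 1) ^ (m s - j) ∧
      DihedralGegenbauer.S N n k 0 θ =
        2 ^ N / Real.Gamma ((n : ℝ) * k + (N : ℝ)) *
          ∑ m ∈ Finset.piAntidiag (Finset.univ : Finset (Fin n)) N,
            ∏ s : Fin n,
              DihedralGegenbauer.poch k (m s) *
                (DihedralGegenbauer.b θ n (s + 1) ^ m s / ((m s).factorial : ℝ)) :=
  ⟨DihedralGegenbauer.S_eq (Nat.one_le_iff_ne_zero.1 hn) hk φ θ N,
    DihedralGegenbauer.S_zero_eq (Nat.one_le_iff_ne_zero.1 hn) hk θ N⟩
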